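/- \textbf{Theorem (Multi-ratio description of generalized Clifford configurations).} Identify $\mathbb{R}^4$ with the quaternions $\mathbb{H}$. Label the vertices of an octahedron by the two-element subsets $ik=ki$ of $\{1,2,3,4\}$, opposite vertices having complementary labels; its eight triangular faces are then the triples $\{ik,il,im\}$ and $\{ik,il,kl\}$ with distinct indices. An \emph{octahedral point-circle configuration} consists of six points $\Phi_{ik}\in\mathbb{H}$ and eight circles (straight lines being admitted as degenerate circles), one for each face, such that $\Phi_{ik}$ lies on the circle of a face if and only if $ik$ is a vertex of that face. The circles are oriented so that the induced orientations of the faces of the octahedron are all the same when viewed from outside. The angle of two oriented circles at a common point is the angle between their tangent vectors (of the same orientation) at that point. Circles through different points \emph{correspond} according to the equivalence relation on pairs (circle $S$, point $P$ of the configuration on $S$) which is generated by: (i) if the distinct circles $S_1,S_2$ share two points $P_1\neq P_2$ of the configuration, then $(S_1;P_1)\leftrightarrow(S_2;P_2)$ and $(S_2;P_1)\leftrightarrow(S_1;P_2)$; (ii) $(S;P)\leftrightarrow(S^*;P^*)$, where $S^*$ and $P^*$ belong to the opposite face and the opposite vertex. The configuration is a \emph{generalized Clifford configuration} if for all points $P,P'$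 of the configuration, all circles $S,T$ through $P$ and the corresponding circles $S',T'$ through $P'$, the angle of $S,T$ at $P$ equals the angle of $S',T'$ at $P'$. For six quaternions with $P_i\ne P_{i+1}$ (indices modulo $6$) put $$M(P_1,\dots,P_6)=(P_1-P_2)(P_2-P_3)^{-1}(P_3-P_4)(P_4-P_5)^{-1}(P_5-P_6)(P_6-P_1)^{-1},$$ $$\tilde M(P_1,\dots,P_6)=(P_1-P_6)^{-1}(P_6-P_5)(P_5-P_4)^{-1}(P_4-P_3)(P_3-P_2)^{-1}(P_2-P_1).$$ The points of every generalized Clifford configuration satisfy $$M(\Phi_{14},\Phi_{12},\Phi_{24},\Phi_{23},\Phi_{34},\Phi_{13})=-1\qquad\text{or}\qquad \tilde M(\Phi_{14},\Phi_{12},\Phi_{24},\Phi_{23},\Phi_{34},\Phi_{13})=-1$$ (possibly both). Conversely, every octahedral point-circle configuration whose six points $\Phi_{ik}$ satisfy at least one of these two conditions is a generalized Clifford configuration. -/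

import Mathlib

open scoped Quaternion

/-! ## The combinatorial octahedron -/

/-- The six vertices `(ik) = (ki)`, `i ≠ k ∈ {1, 2, 3, 4}`, of the octahedron. -/
inductive OctVertex where
  | v12 | v13 | v14 | v23 | v24 | v34

/-- The eight faces of the octahedron: `s i` is the face with the vertices `(ik)`, `k ≠ i`, and
`s ikl` is the face with the vertices `(ik)`, `(kl)`, `(il)`. -/
inductive OctFace where
  | s1 | s2 | s3 | s4 | s123 | s124 | s134 | s234

namespace OctVertex

/-- The opposite vertex: the one with the complementary pair of indices. -/
def opp : OctVertex → OctVertex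
  | v12 => v34
  | v13 => v24
  | v14 => v23
  | v23 => v14
  | v24 => v13
  | v34 => v12

end OctVertex

namespace OctFace

open OctVertex

/-- The three vertices of a face, in the cyclic order given by an orientation of the boundary of
the octahedron: every edge is traversed in opposite directions by its two faces, so all faces have
the same orientation when they are viewed from outside. -/
def vertex : OctFace → Fin 3 → OctVertex
  | s1 => ![v14, v12, v13]
  | s123 => ![v13, v12, v23]
  | s124 => ![v24, v12, v14]
  | s2 => ![v23, v12, v24]
  | s134 => ![v14, v13, v34]
  | s3 => ![v34, v13, v23]
  | s4 => ![v14, v34, v24]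
  | s234 => ![v24, v34, v23]

/-- `f.Has v`: the vertex `v` belongs to the face `f`. -/
def Has (f : OctFace) (v : OctVertex) : Prop := ∃ i : Fin 3, f.vertex i = v

/-- The opposite face: the one whose vertices are the opposites of the vertices of `f`. -/
def opp : OctFace → OctFace
  | s1 => s234
  | s2 => s134
  | s3 => s124
  | s4 => s123
  | s123 => s4
  | s124 => s3
  | s134 => s2
  | s234 => s1

/-- Every edge is traversed in opposite directions by the two faces that contain it: the next
vertex after `w` on one of them is `v` when the next vertex after `v` on the other is `w`. -/
theorem coherent (f : OctFace) (i : Fin 3) :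
    ∃ (g : OctFace) (j : Fin 3), g ≠ f ∧ g.vertex j = f.vertex (i + 1) ∧
      g.vertex (j + 1) = f.vertex i := by
  cases f <;> fin_cases i
  · exact ⟨s124, 1, by simp, rfl, rfl⟩
  · exact ⟨s123, 0, by simp, rfl, rfl⟩
  · exact ⟨s134, 0, by simp, rfl, rfl⟩
  · exact ⟨s123, 1, by simp, rfl, rfl⟩
  · exact ⟨s124, 0, by simp, rfl, rfl⟩
  · exact ⟨s234, 2, by simp, rfl, rfl⟩
  · exact ⟨s134, 1, by simp, rfl, rfl⟩
  · exact ⟨s123, 2, by simp, rfl, rfl⟩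
  · exact ⟨s234, 1, by simp, rfl, rfl⟩
  · exact ⟨s134, 2, by simp, rfl, rfl⟩
  · exact ⟨s234, 0, by simp, rfl, rfl⟩
  · exact ⟨s124, 2, by simp, rfl, rfl⟩
  · exact ⟨s1, 1, by simp, rfl, rfl⟩
  · exact ⟨s2, 0, by simp, rfl, rfl⟩
  · exact ⟨s3, 1, by simp, rfl, rfl⟩
  · exact ⟨s2, 1, by simp, rfl, rfl⟩
  · exact ⟨s1, 0, by simp, rfl, rfl⟩
  · exact ⟨s4, 2, by simp, rfl, rfl⟩
  · exact ⟨s1, 2, by simp, rfl, rfl⟩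
  · exact ⟨s3, 0, by simp, rfl, rfl⟩
  · exact ⟨s4, 0, by simp, rfl, rfl⟩
  · exact ⟨s4, 1, by simp, rfl, rfl⟩
  · exact ⟨s3, 2, by simp, rfl, rfl⟩
  · exact ⟨s2, 2, by simp, rfl, rfl⟩

end OctFace

/-- The correspondence between (face, vertex) pairs: the equivalence relation generated by
`(S₁, S₂; P₁, P₂) ↔ (S₂, S₁; P₂, P₁)`, where `S₁ ≠ S₂` share the vertices `P₁ ≠ P₂`, and
`(S; P) ↔ (S*; P*)`, where the star denotes opposites. -/
inductive OctCorresponds : OctFace → OctVertex → OctFace → OctVertex → Prop where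
  | edge (f g : OctFace) (v w : OctVertex) (hfg : f ≠ g) (hvw : v ≠ w)
      (hfv : f.Has v) (hfw : f.Has w) (hgv : g.Has v) (hgw : g.Has w) : OctCorresponds f v g w
  | opposite (f : OctFace) (v : OctVertex) (hfv : f.Has v) : OctCorresponds f v f.opp v.opp
  | refl (f : OctFace) (v : OctVertex) (hfv : f.Has v) : OctCorresponds f v f v
  | symm {f g : OctFace} {v w : OctVertex} :
      OctCorresponds f v g w → OctCorresponds g w f v
  | trans {f g h : OctFace} {u v w : OctVertex} :
      OctCorresponds f u g v → OctCorresponds g v h w → OctCorresponds f u h w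

/-! ## Oriented circles in the four-dimensional Euclidean space of quaternions -/

/-- An oriented circle of the conformal geometry of `ℝ⁴ ≅ ℍ`. It is either a circle with centre
`o` and radius `r` in the plane through `o` spanned by the orthonormal vectors `u`, `w` (traversed
from `u` towards `w`), or a straight line through `p` with the unit direction vector `u`. -/
inductive OrientedCircle where
  | circle (o u w : ℍ[ℝ]) (r : ℝ) (hr : 0 < r) (hu : ‖u‖ = 1) (hw : ‖w‖ = 1)
      (huw : inner ℝ u w = 0) : OrientedCircle
  | line (p u : ℍ[ℝ]) (hu : ‖u‖ = 1) : OrientedCircle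

namespace OrientedCircle

/-- The standard parametrization of an oriented circle, compatible with the orientation. -/
noncomputable def curve : OrientedCircle → ℝ → ℍ[ℝ]
  | circle o u w r _ _ _ _, t => o + (r * Real.cos t) • u + (r * Real.sin t) • w
  | line p u _, t => p + t • u

/-- The points of an oriented circle. -/
def carrier (C : OrientedCircle) : Set ℍ[ℝ] := Set.range C.curve

/-- The tangent vector, of the same orientation as the circle, at the point `x` of the circle. -/
noncomputable def tangent : OrientedCircle → ℍ[ℝ] → ℍ[ℝ]
  | circle o u w _ _ _ _ _, x => (inner ℝ (x - o) u) • w - (inner ℝ (x - o) w) • u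
  | line _ u _, _ => u

/-- `tangent` is the velocity of the parametrization. -/
theorem hasDerivAt_curve (C : OrientedCircle) (t : ℝ) :
    HasDerivAt C.curve (C.tangent (C.curve t)) t := by
  cases C with
  | circle o u w r hr hu hw huw =>
    have hwu : inner ℝ w u = 0 := by rw [real_inner_comm]; exact huw
    have e : (circle o u w r hr hu hw huw).tangent ((circle o u w r hr hu hw huw).curve t)
        = (r * -Real.sin t) • u + (r * Real.cos t) • w := by
      have h : o + (r * Real.cos t) • u + (r * Real.sin t) • w - o
          = (r * Real.cos t) • u + (r * Real.sin t) • w := by abel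
      simp only [tangent, curve, h, inner_add_left, real_inner_smul_left, huw, hwu,
        real_inner_self_eq_norm_sq, hu, hw]
      module
    rw [e]
    exact (((Real.hasDerivAt_cos t).const_mul r).smul_const u |>.const_add o).add
      (((Real.hasDerivAt_sin t).const_mul r).smul_const w)
  | line p u hu =>
    have h := ((hasDerivAt_id t).smul_const u).const_add p
    rw [one_smul] at h
    exact h

/-- The oriented circle `C` passes through `x`, `y`, `z` in this cyclic order. (A line is closed
up by the point at infinity, hence the three cases.) -/
def Traverses : OrientedCircle → ℍ[ℝ] → ℍ[ℝ] → ℍ[ℝ] → Prop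
  | C@(circle _ _ _ _ _ _ _ _), x, y, z =>
      ∃ a b c : ℝ, C.curve a = x ∧ C.curve b = y ∧ C.curve c = z ∧
        a < b ∧ b < c ∧ c < a + 2 * Real.pi
  | C@(line _ _ _), x, y, z =>
      ∃ a b c : ℝ, C.curve a = x ∧ C.curve b = y ∧ C.curve c = z ∧
        ((a < b ∧ b < c) ∨ (b < c ∧ c < a) ∨ (c < a ∧ a < b))

/-- The angle made by two oriented circles at a common point `x`: the angle, in `[0, π]`, between
their tangent vectors at `x`. -/
noncomputable def angleAt (x : ℍ[ℝ]) (C D : OrientedCircle) : ℝ :=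
  InnerProductGeometry.angle (C.tangent x) (D.tangent x)

end OrientedCircle

/-! ## Octahedral point-circle configurations -/

/-- An octahedral point-circle configuration in `ℝ⁴ ≅ ℍ`: six points and eight circles whose
incidences are exactly those between the vertices and the faces of an octahedron. The circles are
oriented so that the corresponding orientations of the faces of the octahedron agree. -/
structure OctahedralConfiguration where
  /-- The point attached to a vertex. -/
  point : OctVertex → ℍ[ℝ]
  /-- The oriented circle attached to a face. -/
  circle : OctFace → OrientedCircle
  /-- The incidence relation is that of the octahedron. -/
  mem_carrier_iff : ∀ (v : OctVertex) (f : OctFace), point v ∈ (circle f).carrier ↔ f.Has v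
  /-- The orientation convention. -/
  traverses : ∀ f : OctFace, (circle f).Traverses
    (point (f.vertex 0)) (point (f.vertex 1)) (point (f.vertex 2))

/-- An octahedral point-circle configuration is a generalized Clifford configuration if the angles
made by pairs of corresponding oriented circles are the same at all its points. -/
def OctahedralConfiguration.IsGeneralizedClifford (K : OctahedralConfiguration) : Prop :=
  ∀ (v w : OctVertex) (f g f' g' : OctFace),
    OctCorresponds f v f' w → OctCorresponds g v g' w →
      OrientedCircle.angleAt (K.point v) (K.circle f) (K.circle g) =
        OrientedCircle.angleAt (K.point w) (K.circle f') (K.circle g')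

/-! ## Quaternionic multi-ratios -/

/-- The right multi-ratio `M` of six quaternions. -/
noncomputable def rightMultiRatio (p₁ p₂ p₃ p₄ p₅ p₆ : ℍ[ℝ]) : ℍ[ℝ] :=
  (p₁ - p₂) * (p₂ - p₃)⁻¹ * (p₃ - p₄) * (p₄ - p₅)⁻¹ * (p₅ - p₆) * (p₆ - p₁)⁻¹

/-- The left multi-ratio of six quaternions. -/
noncomputable def leftMultiRatio (p₁ p₂ p₃ p₄ p₅ p₆ : ℍ[ℝ]) : ℍ[ℝ] :=
  (p₁ - p₆)⁻¹ * (p₆ - p₅) * (p₅ - p₄)⁻¹ * (p₄ - p₃) * (p₃ - p₂)⁻¹ * (p₂ - p₁)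

/-! Write Q_j for the image of the j-th hexagon vertex P_j under the quaternionic inversion at P_0,
translated so that Q_3 = 0 (`hexInv`). The multi-ratios telescope: M = -1 becomes Q_2⁻¹Q_1 =
Q_4⁻¹Q_5, and the condition on the left multi-ratio becomes Q_1Q_2⁻¹ = Q_5Q_4⁻¹. Up to positive
factors and conjugation, the tangent vectors at P_0 are the sides of the quadrilateral Q_1, Q_2,
Q_4, Q_5. Those at P_1 are also rational in the Q_j, up to fixed factors on both sides, which do not
change angles.

If M = -1, put k = Q_2⁻¹Q_1. Then Q_1 = Q_2k and Q_5 = Q_4k, and the angles at P_0 and P_1 agree by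
cancelling common factors (`SameAngles.normal_form`). The symmetries of the hexagon carry this to
all six vertices, and quaternionic conjugation exchanges the two multi-ratios.

Conversely, the tangent vectors at each of P_0 and P_1 sum to zero, so equal angles nearly determine
them up to scale (`SameAngles.norm_eq`). Comparing P_0 with P_1 and with P_5 shows that the
triangles 0, Q_1, Q_5 and 0, Q_2, Q_4 are similar and that all three pairs of corresponding sides
make the same angle (`similar_of_sameAngles`). In dimension four such a similarity is realized on
these triangles by a left or a right multiplication (`Quaternion.inv_mul_eq_or_mul_inv_eq`), which
gives the two alternatives. -/

namespace Quaternion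

open InnerProductGeometry

/-! ### Angles between quaternions -/

theorem inner_mul_mul_left (c x y : ℍ[ℝ]) :
    inner ℝ (c * x) (c * y) = normSq c * inner ℝ x y := by
  simp only [inner_def, normSq_def', re_mul, imI_mul, imJ_mul, imK_mul, re_star, imI_star,
    imJ_star, imK_star]
  ring

theorem inner_mul_mul_right (c x y : ℍ[ℝ]) :
    inner ℝ (x * c) (y * c) = normSq c * inner ℝ x y := by
  simp only [inner_def, normSq_def', re_mul, imI_mul, imJ_mul, imK_mul, re_star, imI_star,
    imJ_star, imK_star]
  ring

theorem inner_star_star (x y : ℍ[ℝ]) : inner ℝ (star x) (star y) = inner ℝ x y := by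
  simp only [inner_def, re_mul, re_star, imI_star, imJ_star, imK_star]
  ring

theorem angle_mul_left {c : ℍ[ℝ]} (hc : c ≠ 0) (x y : ℍ[ℝ]) :
    angle (c * x) (c * y) = angle x y := by
  have h : normSq c ≠ 0 := normSq_ne_zero.2 hc
  unfold angle
  rw [inner_mul_mul_left, norm_mul, norm_mul, mul_mul_mul_comm, ← normSq_eq_norm_mul_self,
    mul_div_mul_left _ _ h]

theorem angle_mul_right {c : ℍ[ℝ]} (hc : c ≠ 0) (x y : ℍ[ℝ]) :
    angle (x * c) (y * c) = angle x y := by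
  have h : normSq c ≠ 0 := normSq_ne_zero.2 hc
  unfold angle
  rw [inner_mul_mul_right, norm_mul, norm_mul, mul_mul_mul_comm, ← normSq_eq_norm_mul_self c,
    mul_comm (‖x‖ * ‖y‖), mul_div_mul_left _ _ h]

theorem angle_star_star (x y : ℍ[ℝ]) : angle (star x) (star y) = angle x y := by
  unfold angle
  rw [inner_star_star, norm_star, norm_star]

/-- The inverse of a nonzero quaternion is a positive multiple of its conjugate, and conjugation is
an isometry. -/
theorem angle_inv_inv (x y : ℍ[ℝ]) : angle x⁻¹ y⁻¹ = angle x y := by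
  rcases eq_or_ne x 0 with rfl | hx
  · simp
  rcases eq_or_ne y 0 with rfl | hy
  · simp
  have h : ∀ {z : ℍ[ℝ]}, z ≠ 0 → 0 < (normSq z)⁻¹ := fun hz =>
    inv_pos.2 (normSq_nonneg.lt_of_ne' (normSq_ne_zero.2 hz))
  rw [inv_def, inv_def, angle_smul_left_of_pos _ _ (h hx), angle_smul_right_of_pos _ _ (h hy),
    angle_star_star]

end Quaternion

/-- Two families of vectors make the same angles. -/
def SameAngles (f g : Fin 4 → ℍ[ℝ]) : Prop :=
  ∀ i j, InnerProductGeometry.angle (f i) (f j) = InnerProductGeometry.angle (g i) (g j)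

namespace SameAngles

open Quaternion InnerProductGeometry

variable {f g h : Fin 4 → ℍ[ℝ]}

theorem symm (H : SameAngles f g) : SameAngles g f := fun i j => (H i j).symm

theorem trans (H : SameAngles f g) (H' : SameAngles g h) : SameAngles f h :=
  fun i j => (H i j).trans (H' i j)

theorem comp (H : SameAngles f g) (σ : Fin 4 → Fin 4) : SameAngles (f ∘ σ) (g ∘ σ) :=
  fun i j => H (σ i) (σ j)

theorem of_ne_zero (hf : ∀ i, f i ≠ 0) (hg : ∀ i, g i ≠ 0)
    (h01 : angle (f 0) (f 1) = angle (g 0) (g 1)) (h02 : angle (f 0) (f 2) = angle (g 0) (g 2))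
    (h03 : angle (f 0) (f 3) = angle (g 0) (g 3)) (h12 : angle (f 1) (f 2) = angle (g 1) (g 2))
    (h13 : angle (f 1) (f 3) = angle (g 1) (g 3)) (h23 : angle (f 2) (f 3) = angle (g 2) (g 3)) :
    SameAngles f g := by
  have hs : ∀ i, angle (f i) (f i) = angle (g i) (g i) := fun i => by
    rw [angle_self (hf i), angle_self (hg i)]
  have hc : ∀ i j, angle (f i) (f j) = angle (g i) (g j) →
      angle (f j) (f i) = angle (g j) (g i) := fun i j e => by
    rw [angle_comm, e, angle_comm]
  exact fun
    | 0, 0 => hs 0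
    | 0, 1 => h01
    | 0, 2 => h02
    | 0, 3 => h03
    | 1, 0 => hc 0 1 h01
    | 1, 1 => hs 1
    | 1, 2 => h12
    | 1, 3 => h13
    | 2, 0 => hc 0 2 h02
    | 2, 1 => hc 1 2 h12
    | 2, 2 => hs 2
    | 2, 3 => h23
    | 3, 0 => hc 0 3 h03
    | 3, 1 => hc 1 3 h13
    | 3, 2 => hc 2 3 h23
    | 3, 3 => hs 3

end SameAngles

/-! ### Tangent vectors and quaternionic inversion -/

/-- The difference of the images of `y` and `z` under the quaternionic inversion at `x`. It is
conjugate to a tangent vector at `x` of the circle through `x`, `y`, `z` in this order. -/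
noncomputable def invDiff (x y z : ℍ[ℝ]) : ℍ[ℝ] := (y - x)⁻¹ - (z - x)⁻¹

theorem invDiff_eq {x y z : ℍ[ℝ]} (hy : y ≠ x) (hz : z ≠ x) :
    invDiff x y z = (y - x)⁻¹ * (z - y) * (z - x)⁻¹ := by
  rw [invDiff, inv_sub_inv' (sub_ne_zero.2 hy) (sub_ne_zero.2 hz), sub_sub_sub_cancel_right]

theorem invDiff_eq' {x y z : ℍ[ℝ]} (hy : y ≠ x) (hz : z ≠ x) :
    invDiff x y z = (z - x)⁻¹ * (z - y) * (y - x)⁻¹ := by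
  have h : invDiff x y z = -invDiff x z y := (neg_sub _ _).symm
  rw [h, invDiff_eq hz hy, ← neg_sub z y, mul_neg, neg_mul, neg_neg]

theorem invDiff_swap (x y z : ℍ[ℝ]) : invDiff x z y = -invDiff x y z := (neg_sub _ _).symm

theorem invDiff_ne_zero {x y z : ℍ[ℝ]} (h : y ≠ z) : invDiff x y z ≠ 0 := fun e =>
  h (sub_left_injective (inv_injective (sub_eq_zero.1 e)))

theorem invDiff_star (x y z : ℍ[ℝ]) :
    invDiff (star x) (star y) (star z) = star (invDiff x y z) := by
  simp only [invDiff, star_sub, star_inv₀]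

/-- The effect on `invDiff` of an inversion. -/
theorem invDiff_inv {o x y z : ℍ[ℝ]} (hx : x ≠ o) (hy : y ≠ o) (hz : z ≠ o) (hxy : y ≠ x)
    (hxz : z ≠ x) :
    invDiff x y z = -((x - o)⁻¹ * invDiff (x - o)⁻¹ (y - o)⁻¹ (z - o)⁻¹ * (x - o)⁻¹) := by
  -- The first term on the right does not depend on `w`, so it drops out of the difference for `y`
  -- and `z`.
  have key : ∀ w : ℍ[ℝ], w ≠ o → w ≠ x →
      (w - x)⁻¹ = -(x - o)⁻¹ - (x - o)⁻¹ * ((w - o)⁻¹ - (x - o)⁻¹)⁻¹ * (x - o)⁻¹ := by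
    intro w hw hwx
    have h1 := sub_ne_zero.2 hw
    have h2 := sub_ne_zero.2 hx
    have h3 : x - w ≠ 0 := sub_ne_zero.2 hwx.symm
    rw [inv_sub_inv' h1 h2, sub_sub_sub_cancel_right, mul_inv_rev, mul_inv_rev, inv_inv, inv_inv]
    have e : (x - o)⁻¹ * ((x - o) * ((x - w)⁻¹ * (w - o))) * (x - o)⁻¹
        = (x - w)⁻¹ * (w - o) * (x - o)⁻¹ := by
      rw [inv_mul_cancel_left₀ h2]
    rw [e]
    have e2 : w - o = (x - o) - (x - w) := by abel
    rw [e2, mul_sub, sub_mul, inv_mul_cancel₀ h3, mul_assoc, mul_inv_cancel₀ h2, ← neg_sub x w,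
      inv_neg]
    simp only [mul_one, one_mul]
    abel
  rw [invDiff, key y hy hxy, key z hz hxz, invDiff]
  noncomm_ring

/-- The case of `invDiff_inv` in which one argument is the centre `o`: its image is at infinity and
contributes no term. -/
theorem invDiff_at_infinity {o x y : ℍ[ℝ]} (hx : x ≠ o) (hy : y ≠ o) (hxy : y ≠ x) :
    invDiff x o y = (x - o)⁻¹ * ((y - o)⁻¹ - (x - o)⁻¹)⁻¹ * (x - o)⁻¹ := by
  have h1 := sub_ne_zero.2 hy
  have h2 := sub_ne_zero.2 hx
  rw [inv_sub_inv' h1 h2, sub_sub_sub_cancel_right, mul_inv_rev, mul_inv_rev, inv_inv, inv_inv,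
    inv_mul_cancel_left₀ h2, invDiff_eq' hx.symm hxy, ← neg_sub x y, ← neg_sub x o, inv_neg,
    inv_neg]
  noncomm_ring

namespace SameAngles

open Quaternion InnerProductGeometry

/-- Each of the six angles agrees after cancelling a common left or right factor, changing both
signs, or swapping the two vectors. In the application `a`, `b`, `e`, `g` stand for Q_2, Q_4, Q_4 -
Q_2, 1 - k; the second family consists of inverses of the tangent vectors at `P 1`, freed of their
outer factors. -/
theorem normal_form {a b e g k : ℍ[ℝ]} (ha : a ≠ 0) (hb : b ≠ 0) (he : e ≠ 0) (hg : g ≠ 0)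
    (hk : k ≠ 0) (hgk : g * k = k * g) :
    SameAngles ![-(e * k), a * g, e, -(b * g)]
      ![-(a * g), e * k, a * (g * k), -(a * (b⁻¹ * (e * k)))] := by
  refine of_ne_zero (Fin.forall_fin_succ.2 ⟨?_, ?_⟩) (Fin.forall_fin_succ.2 ⟨?_, ?_⟩)
    ?_ ?_ ?_ ?_ ?_ ?_
  · simp [*]
  · simp [Fin.forall_fin_succ, *]
  · simp [*]
  · simp [Fin.forall_fin_succ, *]
  · change angle (-(e * k)) (a * g) = angle (-(a * g)) (e * k)
    rw [angle_comm, ← angle_neg_neg, neg_neg]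
  · change angle (-(e * k)) e = angle (-(a * g)) (a * (g * k))
    have h := angle_mul_left he (-k) 1
    have h' := (angle_mul_left ha (g * -1) (g * k)).trans (angle_mul_left hg (-1) k)
    rw [mul_neg, mul_one] at h h'
    rw [h, ← mul_neg, h', ← angle_neg_neg, neg_neg, angle_comm]
  · change angle (-(e * k)) (-(b * g)) = angle (-(a * g)) (-(a * (b⁻¹ * (e * k))))
    rw [angle_neg_neg, angle_neg_neg, angle_mul_left ha, ← angle_mul_left hb g,
      mul_inv_cancel_left₀ hb, angle_comm]
  · change angle (a * g) e = angle (e * k) (a * (g * k))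
    rw [← mul_assoc, angle_mul_right hk, angle_comm]
  · change angle (a * g) (-(b * g)) = angle (e * k) (-(a * (b⁻¹ * (e * k))))
    have h := angle_mul_right (mul_ne_zero he hk) 1 (-(a * b⁻¹))
    rw [one_mul, ← angle_mul_right hb 1, one_mul, neg_mul, neg_mul, inv_mul_cancel_right₀ hb,
      mul_assoc] at h
    rw [h, ← neg_mul, angle_mul_right hg, angle_comm, ← angle_neg_neg, neg_neg]
  · change angle e (-(b * g)) = angle (a * (g * k)) (-(a * (b⁻¹ * (e * k))))
    have h := angle_mul_right hk g (-(b⁻¹ * e))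
    rw [← angle_mul_left hb g, mul_neg, mul_inv_cancel_left₀ hb, neg_mul, mul_assoc] at h
    rw [← mul_neg a, angle_mul_left ha, h, angle_comm, ← angle_neg_neg, neg_neg]

end SameAngles

/-! ### The hexagon and its multi-ratios after inversion -/

/-- The arguments, besides `P i`, of the conjugate tangent vectors at the vertex `P i` of a hexagon
whose vertices carry an octahedral configuration. The four columns are the classes of
corresponding circles. -/
def hexNext : Fin 6 → Fin 4 → Fin 6 × Fin 6 :=
  ![![(1, 5), (2, 1), (4, 2), (5, 4)], ![(0, 2), (5, 0), (2, 3), (3, 5)],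
    ![(3, 1), (0, 4), (1, 0), (4, 3)], ![(2, 4), (4, 5), (5, 1), (1, 2)],
    ![(5, 3), (3, 2), (0, 5), (2, 0)], ![(4, 0), (1, 3), (3, 4), (0, 1)]]

/-- The conjugate tangent vectors at the vertices of an octahedral configuration. -/
noncomputable def hexTangent (P : Fin 6 → ℍ[ℝ]) (i : Fin 6) (c : Fin 4) : ℍ[ℝ] :=
  invDiff (P i) (P (hexNext i c).1) (P (hexNext i c).2)

/-- The points of a hexagon after the inversion at `P 0` and a translation that moves the image of
`P 3` to the origin. -/
noncomputable def hexInv (P : Fin 6 → ℍ[ℝ]) (j : Fin 6) : ℍ[ℝ] := (P j - P 0)⁻¹ - (P 3 - P 0)⁻¹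

section

variable {P : Fin 6 → ℍ[ℝ]}

theorem hexInv_sub (P : Fin 6 → ℍ[ℝ]) (i j : Fin 6) :
    hexInv P i - hexInv P j = (P i - P 0)⁻¹ - (P j - P 0)⁻¹ := sub_sub_sub_cancel_right _ _ _

theorem hexInv_injective (hP : P.Injective) : (hexInv P).Injective := fun i j h => by
  rw [← sub_eq_zero, hexInv_sub] at h
  exact hP (sub_left_injective (inv_injective (sub_eq_zero.1 h)))

theorem hexInv_three (P : Fin 6 → ℍ[ℝ]) : hexInv P 3 = 0 := sub_self _

theorem hexInv_ne_zero (hP : P.Injective) {j : Fin 6} (hj : j ≠ 3) : hexInv P j ≠ 0 := by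
  rw [← hexInv_three P]
  exact (hexInv_injective hP).ne hj

theorem rightMultiRatio_eq_hexInv (hP : P.Injective) :
    rightMultiRatio (P 0) (P 1) (P 2) (P 3) (P 4) (P 5) =
      -((hexInv P 2 - hexInv P 1)⁻¹ * (hexInv P 3 - hexInv P 2) * (hexInv P 4 - hexInv P 3)⁻¹
        * (hexInv P 5 - hexInv P 4)) := by
  have h : ∀ j : Fin 6, j ≠ 0 → P j - P 0 ≠ 0 := fun j hj => sub_ne_zero.2 (hP.ne hj)
  have e1 : ∀ i j : Fin 6, i ≠ 0 → j ≠ 0 →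
      P i - P j = (P j - P 0) * (hexInv P j - hexInv P i) * (P i - P 0) := by
    intro i j hi hj
    rw [hexInv_sub, inv_sub_inv' (h j hj) (h i hi), sub_sub_sub_cancel_right,
      mul_assoc (P j - P 0)⁻¹, mul_inv_cancel_left₀ (h j hj), mul_assoc,
      inv_mul_cancel₀ (h i hi), mul_one]
  have e2 : ∀ i j : Fin 6, i ≠ 0 → j ≠ 0 →
      P i - P j = (P i - P 0) * (hexInv P j - hexInv P i) * (P j - P 0) := by
    intro i j hi hj
    rw [← neg_sub, e1 j i hj hi, ← neg_sub (hexInv P j), mul_neg, neg_mul,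
      neg_neg]
  -- The two factorizations differ in the order of the outer factors. Using them alternately lets
  -- all differences from `P 0` cancel between neighbours.
  rw [rightMultiRatio, e1 1 2 (by decide) (by decide), e2 2 3 (by decide) (by decide),
    e1 3 4 (by decide) (by decide), e2 4 5 (by decide) (by decide), ← neg_sub (P 1)]
  simp only [mul_inv_rev, mul_assoc, neg_mul]
  rw [mul_inv_cancel_left₀ (h 1 (by decide)), inv_mul_cancel_left₀ (h 2 (by decide)),
    mul_inv_cancel_left₀ (h 3 (by decide)), inv_mul_cancel_left₀ (h 4 (by decide)),
    mul_inv_cancel₀ (h 5 (by decide)), mul_one]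

theorem rightMultiRatio_eq_neg_one_iff (hP : P.Injective) :
    rightMultiRatio (P 0) (P 1) (P 2) (P 3) (P 4) (P 5) = -1 ↔
      (hexInv P 2)⁻¹ * hexInv P 1 = (hexInv P 4)⁻¹ * hexInv P 5 := by
  have h2 := hexInv_ne_zero hP (j := 2) (by decide)
  have h4 := hexInv_ne_zero hP (j := 4) (by decide)
  have h12 : hexInv P 2 - hexInv P 1 ≠ 0 := sub_ne_zero.2 ((hexInv_injective hP).ne (by decide))
  rw [rightMultiRatio_eq_hexInv hP, neg_inj, hexInv_three, zero_sub, sub_zero, mul_assoc,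
    mul_assoc, inv_mul_eq_one₀ h12, mul_sub, inv_mul_cancel₀ h4, mul_sub, mul_one, neg_mul,
    sub_neg_eq_add, neg_add_eq_sub, sub_right_inj, inv_mul_eq_iff_eq_mul₀ h2]

theorem leftMultiRatio_eq_star (p₁ p₂ p₃ p₄ p₅ p₆ : ℍ[ℝ]) :
    leftMultiRatio p₁ p₂ p₃ p₄ p₅ p₆ =
      star (rightMultiRatio (star p₁) (star p₂) (star p₃) (star p₄) (star p₅) (star p₆)) := by
  simp only [leftMultiRatio, rightMultiRatio, ← star_sub, ← star_inv₀, star_mul, star_star,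
    mul_assoc]
  rw [← neg_sub p₆, ← neg_sub p₅ p₆, ← neg_sub p₄ p₅, ← neg_sub p₃ p₄, ← neg_sub p₂ p₃,
    ← neg_sub p₁ p₂]
  simp only [inv_neg, neg_mul, mul_neg, neg_neg]

theorem leftMultiRatio_eq_neg_one_iff_star :
    leftMultiRatio (P 0) (P 1) (P 2) (P 3) (P 4) (P 5) = -1 ↔
      rightMultiRatio (star (P 0)) (star (P 1)) (star (P 2)) (star (P 3)) (star (P 4))
        (star (P 5)) = -1 := by
  rw [leftMultiRatio_eq_star, star_eq_iff_star_eq, star_neg, star_one, eq_comm]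

theorem leftMultiRatio_eq_neg_one_iff (hP : P.Injective) :
    leftMultiRatio (P 0) (P 1) (P 2) (P 3) (P 4) (P 5) = -1 ↔
      hexInv P 1 * (hexInv P 2)⁻¹ = hexInv P 5 * (hexInv P 4)⁻¹ := by
  have e : ∀ j, hexInv (star ∘ P) j = star (hexInv P j) := fun j => by
    simp only [hexInv, Function.comp_apply, star_sub, star_inv₀]
  rw [leftMultiRatio_eq_neg_one_iff_star]
  refine (rightMultiRatio_eq_neg_one_iff (star_injective.comp hP)).trans ?_
  rw [e, e, e, e, ← star_inv₀, ← star_inv₀, ← star_mul, ← star_mul, star_inj]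

/-- The tangent vectors at two adjacent vertices, written in terms of the inverted points. -/
theorem hexTangent_zero_one (hP : P.Injective) :
    hexTangent P 0 = ![hexInv P 1 - hexInv P 5, hexInv P 2 - hexInv P 1,
      hexInv P 4 - hexInv P 2, hexInv P 5 - hexInv P 4] ∧
    ∀ c, hexTangent P 1 c = -((P 1 - P 0)⁻¹ *
      ![-(hexInv P 2 - hexInv P 1)⁻¹, (hexInv P 5 - hexInv P 1)⁻¹,
        invDiff (hexInv P 1) (hexInv P 2) (hexInv P 3),
        invDiff (hexInv P 1) (hexInv P 3) (hexInv P 5)] c * (P 1 - P 0)⁻¹) := by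
  constructor
  · funext c
    fin_cases c <;> exact (hexInv_sub P _ _).symm
  have e : ∀ x y z, invDiff (hexInv P x) (hexInv P y) (hexInv P z) =
      invDiff (P x - P 0)⁻¹ (P y - P 0)⁻¹ (P z - P 0)⁻¹ := fun x y z => by
    simp only [invDiff, hexInv_sub]
  refine Fin.forall_fin_succ.2 ⟨?_, Fin.forall_fin_succ.2 ⟨?_, Fin.forall_fin_succ.2
    ⟨?_, Fin.forall_fin_succ.2 ⟨?_, fun i => i.elim0⟩⟩⟩⟩
  · change invDiff (P 1) (P 0) (P 2) = -((P 1 - P 0)⁻¹ * -(hexInv P 2 - hexInv P 1)⁻¹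
      * (P 1 - P 0)⁻¹)
    rw [invDiff_at_infinity (hP.ne (by decide)) (hP.ne (by decide)) (hP.ne (by decide)),
      hexInv_sub, mul_neg, neg_mul, neg_neg]
  · change invDiff (P 1) (P 5) (P 0) = -((P 1 - P 0)⁻¹ * (hexInv P 5 - hexInv P 1)⁻¹
      * (P 1 - P 0)⁻¹)
    rw [invDiff_swap,
      invDiff_at_infinity (hP.ne (by decide)) (hP.ne (by decide)) (hP.ne (by decide)), hexInv_sub]
  · change invDiff (P 1) (P 2) (P 3) = -((P 1 - P 0)⁻¹ *
      invDiff (hexInv P 1) (hexInv P 2) (hexInv P 3) * (P 1 - P 0)⁻¹)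
    rw [e]
    exact invDiff_inv (hP.ne (by decide)) (hP.ne (by decide)) (hP.ne (by decide))
      (hP.ne (by decide)) (hP.ne (by decide))
  · change invDiff (P 1) (P 3) (P 5) = -((P 1 - P 0)⁻¹ *
      invDiff (hexInv P 1) (hexInv P 3) (hexInv P 5) * (P 1 - P 0)⁻¹)
    rw [e]
    exact invDiff_inv (hP.ne (by decide)) (hP.ne (by decide)) (hP.ne (by decide))
      (hP.ne (by decide)) (hP.ne (by decide))

open InnerProductGeometry Quaternion in
theorem angle_hexTangent_one (hP : P.Injective) (i j : Fin 4) :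
    angle (hexTangent P 1 i) (hexTangent P 1 j) =
      angle (![-(hexInv P 2 - hexInv P 1)⁻¹, (hexInv P 5 - hexInv P 1)⁻¹,
        invDiff (hexInv P 1) (hexInv P 2) (hexInv P 3),
        invDiff (hexInv P 1) (hexInv P 3) (hexInv P 5)] i)
        (![-(hexInv P 2 - hexInv P 1)⁻¹, (hexInv P 5 - hexInv P 1)⁻¹,
        invDiff (hexInv P 1) (hexInv P 2) (hexInv P 3),
        invDiff (hexInv P 1) (hexInv P 3) (hexInv P 5)] j) := by
  have h : (P 1 - P 0)⁻¹ ≠ 0 := inv_ne_zero (sub_ne_zero.2 (hP.ne (by decide)))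
  rw [(hexTangent_zero_one hP).2, (hexTangent_zero_one hP).2, angle_neg_neg, angle_mul_right h,
    angle_mul_left h]

/-- Adjacent vertices have the same angles if the multi-ratio is `-1`. -/
theorem sameAngles_zero_one (hP : P.Injective)
    (hM : rightMultiRatio (P 0) (P 1) (P 2) (P 3) (P 4) (P 5) = -1) :
    SameAngles (hexTangent P 0) (hexTangent P 1) := by
  rw [rightMultiRatio_eq_neg_one_iff hP] at hM
  have h := hexInv_injective hP
  have h0 : ∀ {j}, j ≠ 3 → hexInv P j ≠ 0 := hexInv_ne_zero hP
  intro i j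
  rw [angle_hexTangent_one hP, (hexTangent_zero_one hP).1]
  have ha := h0 (j := 2) (by decide)
  have hb := h0 (j := 4) (by decide)
  -- The reduced condition says that the same right factor `k` carries Q_2 to Q_1 and Q_4 to Q_5.
  obtain ⟨k, hk⟩ : ∃ k, (hexInv P 2)⁻¹ * hexInv P 1 = k := ⟨_, rfl⟩
  have e1 : hexInv P 1 = hexInv P 2 * k := by rw [← hk, mul_inv_cancel_left₀ ha]
  have e5 : hexInv P 5 = hexInv P 4 * k := by rw [← hk, hM, mul_inv_cancel_left₀ hb]
  have hk0 : k ≠ 0 := by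
    rintro rfl
    exact h0 (j := 1) (by decide) (by simpa using e1)
  have hg : 1 - k ≠ 0 := by
    intro e
    have : k = 1 := (sub_eq_zero.1 e).symm
    rw [this, mul_one] at e1
    exact absurd (h e1) (by decide)
  have he : hexInv P 4 - hexInv P 2 ≠ 0 := sub_ne_zero.2 (h.ne (by decide))
  have key := SameAngles.normal_form ha hb he hg hk0 (by rw [mul_sub, sub_mul, mul_one, one_mul])
  have d21 : hexInv P 2 - hexInv P 1 = hexInv P 2 * (1 - k) := by rw [e1, mul_sub, mul_one]
  have d51 : hexInv P 5 - hexInv P 1 = (hexInv P 4 - hexInv P 2) * k := by rw [e1, e5, sub_mul]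
  have d15 : hexInv P 1 - hexInv P 5 = -((hexInv P 4 - hexInv P 2) * k) := by rw [← d51, neg_sub]
  have d54 : hexInv P 5 - hexInv P 4 = -(hexInv P 4 * (1 - k)) := by
    rw [e5, mul_sub, mul_one, neg_sub]
  have hs : ![hexInv P 1 - hexInv P 5, hexInv P 2 - hexInv P 1, hexInv P 4 - hexInv P 2,
      hexInv P 5 - hexInv P 4] = ![-((hexInv P 4 - hexInv P 2) * k), hexInv P 2 * (1 - k),
        hexInv P 4 - hexInv P 2, -(hexInv P 4 * (1 - k))] := by rw [d15, d21, d54]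
  have ht : ∀ c, (![-(hexInv P 2 - hexInv P 1)⁻¹, (hexInv P 5 - hexInv P 1)⁻¹,
      invDiff (hexInv P 1) (hexInv P 2) (hexInv P 3),
      invDiff (hexInv P 1) (hexInv P 3) (hexInv P 5)] c)⁻¹ =
      ![-(hexInv P 2 * (1 - k)), (hexInv P 4 - hexInv P 2) * k, hexInv P 2 * ((1 - k) * k),
        -(hexInv P 2 * ((hexInv P 4)⁻¹ * ((hexInv P 4 - hexInv P 2) * k)))] c := by
    refine Fin.forall_fin_succ.2 ⟨?_, Fin.forall_fin_succ.2 ⟨?_, Fin.forall_fin_succ.2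
      ⟨?_, Fin.forall_fin_succ.2 ⟨?_, fun i => i.elim0⟩⟩⟩⟩
    · change (-(hexInv P 2 - hexInv P 1)⁻¹)⁻¹ = -(hexInv P 2 * (1 - k))
      rw [inv_neg, inv_inv, d21]
    · change ((hexInv P 5 - hexInv P 1)⁻¹)⁻¹ = (hexInv P 4 - hexInv P 2) * k
      rw [inv_inv, d51]
    · change (invDiff (hexInv P 1) (hexInv P 2) (hexInv P 3))⁻¹ = hexInv P 2 * ((1 - k) * k)
      rw [invDiff_eq' (h.ne (by decide)) (h.ne (by decide)), d21, hexInv_three, e1, zero_sub,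
        zero_sub, inv_neg, neg_mul_neg]
      simp only [mul_inv_rev, inv_inv, mul_assoc]
      rw [inv_mul_cancel_left₀ ha]
    · change (invDiff (hexInv P 1) (hexInv P 3) (hexInv P 5))⁻¹ =
        -(hexInv P 2 * ((hexInv P 4)⁻¹ * ((hexInv P 4 - hexInv P 2) * k)))
      rw [invDiff_eq' (h.ne (by decide)) (h.ne (by decide)), d51, hexInv_three, zero_sub,
        sub_zero, inv_neg, mul_neg, inv_neg, mul_inv_rev, mul_inv_rev, inv_inv, inv_inv, e1, e5,
        mul_inv_rev, mul_assoc, mul_assoc, mul_inv_cancel_left₀ hk0]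
  rw [← Quaternion.angle_inv_inv (Matrix.vecCons (-(_)⁻¹) _ _), ht, ht, hs]
  exact key i j

end

/-! ### Symmetries of the hexagon -/

section

variable {P : Fin 6 → ℍ[ℝ]}

/-- The rotation of the hexagon by two steps is an orientation-preserving symmetry of the
octahedron, and permutes the classes of circles. -/
theorem hexTangent_comp_add_two (P : Fin 6 → ℍ[ℝ]) (i : Fin 6) :
    hexTangent P (i + 2) = hexTangent (P ∘ (· + 2)) i ∘ ![0, 2, 3, 1] := by
  funext c
  fin_cases i <;> fin_cases c <;> rfl

/-- The reflection of the hexagon reverses the orientation of the octahedron, whence the sign; a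
sign common to all vectors leaves the angles unchanged. -/
theorem hexTangent_comp_neg (P : Fin 6 → ℍ[ℝ]) (i : Fin 6) (c : Fin 4) :
    hexTangent P (-i) c = -hexTangent (P ∘ Neg.neg) i (![0, 3, 2, 1] c) := by
  have h : ∀ i c, hexTangent P (-i) c = invDiff (P (-i)) (P (-(hexNext i (![0, 3, 2, 1] c)).2))
      (P (-(hexNext i (![0, 3, 2, 1] c)).1)) := by
    intro i c
    fin_cases i <;> fin_cases c <;> rfl
  rw [h, invDiff_swap]
  rfl

theorem SameAngles.of_comp_neg {i j : Fin 6}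
    (h : SameAngles (hexTangent (P ∘ Neg.neg) i) (hexTangent (P ∘ Neg.neg) j)) :
    SameAngles (hexTangent P (-i)) (hexTangent P (-j)) := fun a b => by
  rw [hexTangent_comp_neg, hexTangent_comp_neg, hexTangent_comp_neg, hexTangent_comp_neg,
    InnerProductGeometry.angle_neg_neg, InnerProductGeometry.angle_neg_neg]
  exact h _ _

theorem SameAngles.of_comp_add_two {i j : Fin 6}
    (h : SameAngles (hexTangent (P ∘ (· + 2)) i) (hexTangent (P ∘ (· + 2)) j)) :
    SameAngles (hexTangent P (i + 2)) (hexTangent P (j + 2)) := by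
  rw [hexTangent_comp_add_two, hexTangent_comp_add_two]
  exact h.comp _

theorem rightMultiRatio_rotate {p₁ p₂ p₃ p₄ p₅ p₆ : ℍ[ℝ]}
    (h : rightMultiRatio p₁ p₂ p₃ p₄ p₅ p₆ = -1) : rightMultiRatio p₃ p₄ p₅ p₆ p₁ p₂ = -1 := by
  have e : (p₁ - p₂) * (p₂ - p₃)⁻¹ *
      -((p₃ - p₄) * (p₄ - p₅)⁻¹ * (p₅ - p₆) * (p₆ - p₁)⁻¹) = 1 := by
    rw [mul_neg, neg_eq_iff_eq_neg, ← h]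
    simp only [rightMultiRatio, mul_assoc]
  have e' := mul_eq_one_comm.1 e
  rw [neg_mul, neg_eq_iff_eq_neg] at e'
  rw [← e']
  simp only [rightMultiRatio, mul_assoc]

/-- The reflection exchanges Q_1 with Q_5 and Q_2 with Q_4, which only swaps the two sides of the
reduced condition. -/
theorem rightMultiRatio_comp_neg (hP : P.Injective)
    (h : rightMultiRatio (P 0) (P 1) (P 2) (P 3) (P 4) (P 5) = -1) :
    rightMultiRatio (P 0) (P 5) (P 4) (P 3) (P 2) (P 1) = -1 :=
  (rightMultiRatio_eq_neg_one_iff (P := P ∘ Neg.neg) (hP.comp neg_injective)).2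
    ((rightMultiRatio_eq_neg_one_iff hP).1 h).symm

theorem sameAngles_zero_five (hP : P.Injective)
    (hM : rightMultiRatio (P 0) (P 1) (P 2) (P 3) (P 4) (P 5) = -1) :
    SameAngles (hexTangent P 0) (hexTangent P 5) :=
  SameAngles.of_comp_neg (P := P) (i := 0) (j := 1)
    (sameAngles_zero_one (P := P ∘ Neg.neg) (hP.comp neg_injective)
      (rightMultiRatio_comp_neg (P := P) hP hM))

theorem sameAngles_two (hP : P.Injective)
    (hM : rightMultiRatio (P 0) (P 1) (P 2) (P 3) (P 4) (P 5) = -1) :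
    SameAngles (hexTangent P 2) (hexTangent P 3) ∧ SameAngles (hexTangent P 2) (hexTangent P 1) :=
  have hM2 : rightMultiRatio (P 2) (P 3) (P 4) (P 5) (P 0) (P 1) = -1 := rightMultiRatio_rotate hM
  have hP2 : (P ∘ (· + 2)).Injective := hP.comp (add_left_injective 2)
  ⟨SameAngles.of_comp_add_two (P := P) (i := 0) (j := 1)
    (sameAngles_zero_one (P := P ∘ (· + 2)) hP2 hM2),
  SameAngles.of_comp_add_two (P := P) (i := 0) (j := 5)
    (sameAngles_zero_five (P := P ∘ (· + 2)) hP2 hM2)⟩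

theorem sameAngles_four_five (hP : P.Injective)
    (hM : rightMultiRatio (P 0) (P 1) (P 2) (P 3) (P 4) (P 5) = -1) :
    SameAngles (hexTangent P 4) (hexTangent P 5) :=
  have hM2 : rightMultiRatio (P 2) (P 3) (P 4) (P 5) (P 0) (P 1) = -1 := rightMultiRatio_rotate hM
  SameAngles.of_comp_add_two (P := P) (i := 2) (j := 3)
    (sameAngles_two (P := P ∘ (· + 2)) (hP.comp (add_left_injective 2)) hM2).1

/-- All vertices have the same angles if the multi-ratio is `-1`. -/
theorem sameAngles_of_rightMultiRatio (hP : P.Injective)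
    (hM : rightMultiRatio (P 0) (P 1) (P 2) (P 3) (P 4) (P 5) = -1) (i j : Fin 6) :
    SameAngles (hexTangent P i) (hexTangent P j) := by
  have a := sameAngles_zero_one hP hM
  have b := sameAngles_zero_five hP hM
  have c := sameAngles_two hP hM
  have d := sameAngles_four_five hP hM
  have h0 : ∀ i, SameAngles (hexTangent P 0) (hexTangent P i) := by
    intro i
    fin_cases i
    exacts [fun _ _ => rfl, a, a.trans c.2.symm, a.trans (c.2.symm.trans c.1), b.trans d.symm, b]
  exact (h0 i).symm.trans (h0 j)

theorem sameAngles_of_leftMultiRatio (hP : P.Injective)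
    (hM : leftMultiRatio (P 0) (P 1) (P 2) (P 3) (P 4) (P 5) = -1) (i j : Fin 6) :
    SameAngles (hexTangent P i) (hexTangent P j) := fun a b => by
  have h := sameAngles_of_rightMultiRatio (P := star ∘ P) (star_injective.comp hP)
    (leftMultiRatio_eq_neg_one_iff_star.1 hM) i j a b
  have e : ∀ i c, hexTangent (star ∘ P) i c = star (hexTangent P i c) := fun i c =>
    invDiff_star _ _ _
  rwa [e, e, e, e, Quaternion.angle_star_star, Quaternion.angle_star_star] at h

/-! ### From equal angles to the multi-ratio -/

/-- Two families of four vectors with sum zero and the same angles are similar if the ratio of the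
lengths of the first two vectors is the same and the last two are linearly independent. -/
theorem SameAngles.norm_eq {f g : Fin 4 → ℍ[ℝ]} (H : SameAngles f g) (hf : ∀ i, f i ≠ 0)
    (hg : ∀ i, g i ≠ 0) (sf : f 0 + f 1 + f 2 + f 3 = 0) (sg : g 0 + g 1 + g 2 + g 3 = 0)
    {s : ℝ} (h0 : ‖g 0‖ = s * ‖f 0‖) (h1 : ‖g 1‖ = s * ‖f 1‖)
    (hind : ∀ α β : ℝ, α • f 2 + β • f 3 = 0 → α = 0) : ‖g 2‖ = s * ‖f 2‖ := by
  have nf : ∀ i, ‖f i‖ ≠ 0 := fun i => norm_ne_zero_iff.2 (hf i)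
  have ng : ∀ i, ‖g i‖ ≠ 0 := fun i => norm_ne_zero_iff.2 (hg i)
  -- Rescaling each `g i` to the length of `f i` makes the Gram matrices equal, so the two families
  -- satisfy the same linear relations.
  obtain ⟨w, hw⟩ : ∃ w : Fin 4 → ℍ[ℝ], ∀ i, w i = (‖f i‖ / ‖g i‖) • g i := ⟨_, fun _ => rfl⟩
  have hin : ∀ i j, inner ℝ (w i) (w j) = inner ℝ (f i) (f j) := by
    intro i j
    rw [hw, hw, real_inner_smul_left, real_inner_smul_right,
      ← InnerProductGeometry.cos_angle_mul_norm_mul_norm (g i),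
      ← InnerProductGeometry.cos_angle_mul_norm_mul_norm (f i), H i j]
    have := ng i
    have := ng j
    field_simp
  have hcomb : ∀ c : Fin 4 → ℝ, ∑ i, c i • w i = 0 ↔ ∑ i, c i • f i = 0 := by
    intro c
    rw [← inner_self_eq_zero (𝕜 := ℝ), ← inner_self_eq_zero (𝕜 := ℝ) (x := ∑ i, c i • f i)]
    simp only [sum_inner, inner_sum, real_inner_smul_left, real_inner_smul_right, hin]
  have hgw : ∀ i, g i = (‖g i‖ / ‖f i‖) • w i := fun i => by
    rw [hw, smul_smul, div_mul_div_cancel₀ (nf i), div_self (ng i), one_smul]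
  have sw := (hcomb fun _ => 1).2 (by simpa [Fin.sum_univ_four] using sf)
  rw [hgw 0, hgw 1, hgw 2, hgw 3, h0, h1, mul_div_cancel_right₀ _ (nf 0),
    mul_div_cancel_right₀ _ (nf 1)] at sg
  -- Subtracting the relation of `g` from `s` times the relation of `w` kills the first two
  -- coefficients.
  have key := (hcomb ![0, 0, s - ‖g 2‖ / ‖f 2‖, s - ‖g 3‖ / ‖f 3‖]).1 (by
    simp only [Fin.sum_univ_four, one_smul] at sw
    simp only [Fin.sum_univ_four, Matrix.cons_val, zero_smul, zero_add, sub_smul]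
    have e : s • (w 0 + w 1 + w 2 + w 3) = 0 := by rw [sw, smul_zero]
    rw [← e.trans sg.symm |> sub_eq_zero.2]
    simp only [smul_add]
    abel)
  simp only [Fin.sum_univ_four, Matrix.cons_val, zero_smul, zero_add] at key
  have := hind _ _ key
  rw [sub_eq_zero.1 this, div_mul_cancel₀ _ (nf 2)]

end

namespace Quaternion

/-- If `g - 1` and `g * k - l` are related like `g` and `g * k`, and like `1` and `l`, then `k`
and `l` are equal or conjugated by `g`. -/
theorem eq_or_mul_eq_mul {g k l : ℍ[ℝ]} (hre : l.re = k.re) (hn : normSq l = normSq k)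
    (h1 : inner ℝ (g * k - l) (g - 1) = k.re * normSq (g - 1))
    (h2 : normSq (g * k - l) = normSq k * normSq (g - 1)) : k = l ∨ g * k = l * g := by
  rw [or_iff_not_imp_left]
  intro hkl
  simp only [Quaternion.ext_iff, inner_def, normSq_def', re_mul, imI_mul, imJ_mul, imK_mul,
    re_star, imI_star, imJ_star, imK_star, re_sub, imI_sub, imJ_sub, imK_sub, re_one, imI_one,
    imJ_one, imK_one, hre] at hn h1 h2 hkl ⊢
  generalize g.re = g0, g.imI = g1, g.imJ = g2, g.imK = g3, k.re = r, k.imI = m1, k.imJ = m2,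
    k.imK = m3, l.imI = n1, l.imJ = n2, l.imK = n3 at hn h1 h2 hkl ⊢
  -- With m, n the imaginary parts of `k`, `l`: the imaginary part of `g` is orthogonal to m - n,
  -- and `F3` says that m and n have the same length.
  have F1 : g1 * (m1 - n1) + g2 * (m2 - n2) + g3 * (m3 - n3) = 0 := by
    linear_combination h1
  have F2 : g0 * (m1 ^ 2 + m2 ^ 2 + m3 ^ 2 - m1 * n1 - m2 * n2 - m3 * n3) -
      (g1 * (m2 * n3 - m3 * n2) + g2 * (m3 * n1 - m1 * n3) + g3 * (m1 * n2 - m2 * n1)) = 0 := by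
    linear_combination h2 / 2 - hn / 2 - r * F1
  have F3 : (m1 + n1) * (m1 - n1) + (m2 + n2) * (m2 - n2) + (m3 + n3) * (m3 - n3) = 0 := by
    linear_combination -hn
  have hD : (m1 - n1) ^ 2 + (m2 - n2) ^ 2 + (m3 - n3) ^ 2 ≠ 0 := by
    intro h
    obtain ⟨h', e3⟩ := (add_eq_zero_iff_of_nonneg (by positivity) (by positivity)).1 h
    obtain ⟨e1, e2⟩ := (add_eq_zero_iff_of_nonneg (by positivity) (by positivity)).1 h'
    exact hkl ⟨trivial, sub_eq_zero.1 (pow_eq_zero_iff two_ne_zero |>.1 e1),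
      sub_eq_zero.1 (pow_eq_zero_iff two_ne_zero |>.1 e2),
      sub_eq_zero.1 (pow_eq_zero_iff two_ne_zero |>.1 e3)⟩
  -- The vector v is the imaginary part of `g * k - l * g`. It is orthogonal to m - n by `hv` and
  -- parallel to it by `c1`, `c2`, `c3`; as m - n is nonzero, v vanishes.
  obtain ⟨v1, hv1⟩ : ∃ v, v = g0 * (m1 - n1) + (g2 * (m3 + n3) - g3 * (m2 + n2)) := ⟨_, rfl⟩
  obtain ⟨v2, hv2⟩ : ∃ v, v = g0 * (m2 - n2) + (g3 * (m1 + n1) - g1 * (m3 + n3)) := ⟨_, rfl⟩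
  obtain ⟨v3, hv3⟩ : ∃ v, v = g0 * (m3 - n3) + (g1 * (m2 + n2) - g2 * (m1 + n1)) := ⟨_, rfl⟩
  have hv : v1 * (m1 - n1) + v2 * (m2 - n2) + v3 * (m3 - n3) = 0 := by
    rw [hv1, hv2, hv3]
    linear_combination 2 * F2 - g0 * F3
  have c1 : v2 * (m3 - n3) - v3 * (m2 - n2) = 0 := by
    rw [hv2, hv3]
    linear_combination (m1 + n1) * F1 - g1 * F3
  have c2 : v3 * (m1 - n1) - v1 * (m3 - n3) = 0 := by
    rw [hv3, hv1]
    linear_combination (m2 + n2) * F1 - g2 * F3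
  have c3 : v1 * (m2 - n2) - v2 * (m1 - n1) = 0 := by
    rw [hv1, hv2]
    linear_combination (m3 + n3) * F1 - g3 * F3
  have z1 : v1 = 0 := (mul_eq_zero.1 (by
    linear_combination (m1 - n1) * hv + (m2 - n2) * c3 - (m3 - n3) * c2 :
      v1 * ((m1 - n1) ^ 2 + (m2 - n2) ^ 2 + (m3 - n3) ^ 2) = 0)).resolve_right hD
  have z2 : v2 = 0 := (mul_eq_zero.1 (by
    linear_combination (m2 - n2) * hv + (m3 - n3) * c1 - (m1 - n1) * c3 :
      v2 * ((m1 - n1) ^ 2 + (m2 - n2) ^ 2 + (m3 - n3) ^ 2) = 0)).resolve_right hD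
  have z3 : v3 = 0 := (mul_eq_zero.1 (by
    linear_combination (m3 - n3) * hv + (m1 - n1) * c2 - (m2 - n2) * c1 :
      v3 * ((m1 - n1) ^ 2 + (m2 - n2) ^ 2 + (m3 - n3) ^ 2) = 0)).resolve_right hD
  rw [z1] at hv1
  rw [z2] at hv2
  rw [z3] at hv3
  refine ⟨?_, ?_, ?_, ?_⟩
  · linear_combination -F1
  · linear_combination -hv1
  · linear_combination -hv2
  · linear_combination -hv3

/-- Two pairs of vectors that are similar to each other, with the same similarity of their
differences, are related by the left or by the right multiplication with a quaternion. -/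
theorem inv_mul_eq_or_mul_inv_eq {a b x y : ℍ[ℝ]} (ha : a ≠ 0) (hb : b ≠ 0)
    {κ : ℝ} (nx : ‖x‖ = κ * ‖a‖) (ny : ‖y‖ = κ * ‖b‖) (nxy : ‖x - y‖ = κ * ‖a - b‖)
    (h : InnerProductGeometry.angle x a = InnerProductGeometry.angle y b)
    (h' : InnerProductGeometry.angle x a = InnerProductGeometry.angle (x - y) (a - b)) :
    a⁻¹ * x = b⁻¹ * y ∨ x * a⁻¹ = y * b⁻¹ := by
  -- Factoring out `b` on the left, and `b * g` from `x`, turns the hypotheses into equality of the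
  -- norms and real parts of `k` and `l`, together with relations for `g - 1` and `g * k - l`.
  obtain ⟨g, rfl⟩ : ∃ g, a = b * g := ⟨b⁻¹ * a, (mul_inv_cancel_left₀ hb a).symm⟩
  obtain ⟨k, rfl⟩ : ∃ k, x = b * g * k := ⟨(b * g)⁻¹ * x, (mul_inv_cancel_left₀ ha x).symm⟩
  obtain ⟨l, rfl⟩ : ∃ l, y = b * l := ⟨b⁻¹ * y, (mul_inv_cancel_left₀ hb y).symm⟩
  have hg : g ≠ 0 := right_ne_zero_of_mul ha
  have nb : ‖b‖ ≠ 0 := norm_ne_zero_iff.2 hb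
  have ng : ‖g‖ ≠ 0 := norm_ne_zero_iff.2 hg
  have e1 : b * g * k - b * l = b * (g * k - l) := by rw [mul_sub, mul_assoc]
  have e2 : b * g - b = b * (g - 1) := by rw [mul_sub, mul_one]
  have a1 := angle_mul_left ha k 1
  have a2 := angle_mul_left hb l 1
  rw [mul_one] at a1 a2
  rw [a1] at h h'
  rw [a2] at h
  rw [e1, e2, angle_mul_left hb] at h'
  rw [e1, e2, norm_mul, norm_mul, mul_left_comm, mul_right_inj' nb] at nxy
  rw [norm_mul, mul_comm, mul_left_inj' (norm_ne_zero_iff.2 ha)] at nx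
  rw [norm_mul, mul_comm, mul_left_inj' nb] at ny
  have rk : ∀ z : ℍ[ℝ], z.re = Real.cos (InnerProductGeometry.angle z 1) * ‖z‖ := fun z => by
    have := InnerProductGeometry.cos_angle_mul_norm_mul_norm z 1
    rw [norm_one, mul_one] at this
    rw [this, inner_def, star_one, mul_one]
  rcases eq_or_mul_eq_mul (g := g) (k := k) (l := l) (by rw [rk l, rk k, h, nx, ny])
    (by rw [normSq_eq_norm_mul_self, normSq_eq_norm_mul_self, nx, ny])
    (by rw [← InnerProductGeometry.cos_angle_mul_norm_mul_norm, rk k, h', nxy, nx,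
          normSq_eq_norm_mul_self]; ring)
    (by rw [normSq_eq_norm_mul_self, normSq_eq_norm_mul_self, normSq_eq_norm_mul_self, nx, nxy]
        ring) with e | e
  · left
    rw [inv_mul_cancel_left₀ ha, inv_mul_cancel_left₀ hb, e]
  · right
    rw [mul_assoc b g, e, ← mul_assoc, mul_inv_rev, mul_assoc (b * l), mul_inv_cancel_left₀ hg]

end Quaternion

section

open InnerProductGeometry Quaternion

variable {P : Fin 6 → ℍ[ℝ]}

theorem similar_of_sameAngles (hP : P.Injective)
    (H : SameAngles (hexTangent P 0) (hexTangent P 1))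
    (hind : ∀ α β : ℝ, α • (hexInv P 4 - hexInv P 2) + β • (hexInv P 5 - hexInv P 4) = 0 → α = 0) :
    ‖hexInv P 1‖ * ‖hexInv P 4 - hexInv P 2‖ = ‖hexInv P 1 - hexInv P 5‖ * ‖hexInv P 2‖ ∧
      angle (hexInv P 1) (hexInv P 2) =
        angle (hexInv P 1 - hexInv P 5) (hexInv P 2 - hexInv P 4) := by
  have h := hexInv_injective hP
  have d : ∀ {i j}, i ≠ j → hexInv P i - hexInv P j ≠ 0 := fun hij => sub_ne_zero.2 (h.ne hij)
  have n : ∀ {i j}, i ≠ j → ‖hexInv P i - hexInv P j‖ ≠ 0 := fun hij => norm_ne_zero_iff.2 (d hij)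
  have h1 : hexInv P 1 ≠ 0 := hexInv_ne_zero hP (by decide)
  have n1 : ‖hexInv P 1‖ ≠ 0 := norm_ne_zero_iff.2 h1
  obtain ⟨f, hf⟩ : ∃ f, f = ![hexInv P 1 - hexInv P 5, hexInv P 2 - hexInv P 1,
    hexInv P 4 - hexInv P 2, hexInv P 5 - hexInv P 4] := ⟨_, rfl⟩
  obtain ⟨g, hg⟩ : ∃ g, g = ![-(hexInv P 2 - hexInv P 1)⁻¹, (hexInv P 5 - hexInv P 1)⁻¹,
    invDiff (hexInv P 1) (hexInv P 2) (hexInv P 3),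
    invDiff (hexInv P 1) (hexInv P 3) (hexInv P 5)] := ⟨_, rfl⟩
  have H' : SameAngles f g := fun i j => by
    rw [hf, hg, ← angle_hexTangent_one hP, ← (hexTangent_zero_one hP).1]
    exact H i j
  have g2 : g 2 = (hexInv P 2 - hexInv P 1)⁻¹ * (hexInv P 2 * (hexInv P 1)⁻¹) := by
    rw [hg]
    change invDiff (hexInv P 1) (hexInv P 2) (hexInv P 3) = _
    rw [invDiff_eq (h.ne (by decide)) (h.ne (by decide)), hexInv_three, zero_sub, zero_sub,
      inv_neg, mul_assoc, neg_mul_neg]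
  constructor
  -- Up to sign, `g 0` and `g 1` are the inverses of `f 1` and `f 0`, so both length ratios equal
  -- the inverse of the product of the lengths of `f 0` and `f 1`.
  · have key := H'.norm_eq (s := (‖hexInv P 1 - hexInv P 5‖ * ‖hexInv P 2 - hexInv P 1‖)⁻¹)
      (by rw [hf]; simp [Fin.forall_fin_succ, d])
      (by
        rw [hg]
        simp [Fin.forall_fin_succ, d]
        exact ⟨invDiff_ne_zero (h.ne (by decide)), invDiff_ne_zero (h.ne (by decide))⟩)
      (by rw [hf]; simp)
      (by rw [hg]; simp only [Matrix.cons_val, invDiff]; abel)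
      (by
        rw [hf, hg]
        simp only [Matrix.cons_val, norm_neg, norm_inv]
        have := n (i := 1) (j := 5) (by decide)
        field_simp)
      (by
        rw [hf, hg]
        simp only [Matrix.cons_val, norm_inv]
        rw [norm_sub_rev (hexInv P 5)]
        have := n (i := 2) (j := 1) (by decide)
        field_simp)
      (by rw [hf]; exact hind)
    rw [g2, hf] at key
    simp only [Matrix.cons_val, norm_mul, norm_inv] at key
    have := n (i := 2) (j := 1) (by decide)
    have := n (i := 1) (j := 5) (by decide)
    field_simp at key
    linear_combination -key
  · have key := H' 0 2
    rw [g2, hf, hg] at key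
    change angle (hexInv P 1 - hexInv P 5) (hexInv P 4 - hexInv P 2) =
      angle (-(hexInv P 2 - hexInv P 1)⁻¹)
        ((hexInv P 2 - hexInv P 1)⁻¹ * (hexInv P 2 * (hexInv P 1)⁻¹)) at key
    have e := (angle_mul_left (inv_ne_zero (d (i := 2) (j := 1) (by decide))) (-1)
      (hexInv P 2 * (hexInv P 1)⁻¹)).trans (angle_mul_right h1 _ _).symm
    rw [mul_neg, mul_one, inv_mul_cancel_right₀ h1, neg_mul, one_mul] at e
    rw [e, ← neg_sub (hexInv P 2), angle_neg_right, angle_neg_left] at key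
    linarith

/-- If the angles are the same at the vertices `0`, `1` and `5`, then one of the multi-ratios
is `-1`. -/
theorem multiRatio_of_sameAngles (hP : P.Injective)
    (H : SameAngles (hexTangent P 0) (hexTangent P 1))
    (H' : SameAngles (hexTangent P 0) (hexTangent P 5))
    (hind : ∀ α β : ℝ, α • (hexInv P 4 - hexInv P 2) + β • (hexInv P 5 - hexInv P 4) = 0 → α = 0)
    (hind' : ∀ α β : ℝ,
      α • (hexInv P 2 - hexInv P 4) + β • (hexInv P 1 - hexInv P 2) = 0 → α = 0) :
    rightMultiRatio (P 0) (P 1) (P 2) (P 3) (P 4) (P 5) = -1 ∨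
      leftMultiRatio (P 0) (P 1) (P 2) (P 3) (P 4) (P 5) = -1 := by
  rw [rightMultiRatio_eq_neg_one_iff hP, leftMultiRatio_eq_neg_one_iff hP]
  have h := hexInv_injective hP
  have h2 : hexInv P 2 ≠ 0 := hexInv_ne_zero hP (by decide)
  have h4 : hexInv P 4 ≠ 0 := hexInv_ne_zero hP (by decide)
  have n24 : ‖hexInv P 2 - hexInv P 4‖ ≠ 0 :=
    norm_ne_zero_iff.2 (sub_ne_zero.2 (h.ne (by decide)))
  obtain ⟨a, b⟩ := similar_of_sameAngles hP H hind
  have H'' : SameAngles (hexTangent (P ∘ Neg.neg) 0) (hexTangent (P ∘ Neg.neg) 1) := by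
    refine SameAngles.of_comp_neg (P := P ∘ Neg.neg) (i := 0) (j := 5) ?_
    have e : (P ∘ Neg.neg) ∘ Neg.neg = P := by
      funext i
      exact congrArg P (neg_neg i)
    rw [e]
    exact H'
  have e : hexInv (P ∘ Neg.neg) 1 = hexInv P 5 ∧ hexInv (P ∘ Neg.neg) 2 = hexInv P 4 ∧
      hexInv (P ∘ Neg.neg) 4 = hexInv P 2 ∧ hexInv (P ∘ Neg.neg) 5 = hexInv P 1 :=
    ⟨rfl, rfl, rfl, rfl⟩
  have key := similar_of_sameAngles (P := P ∘ Neg.neg) (hP.comp neg_injective) H''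
  rw [e.1, e.2.1, e.2.2.1, e.2.2.2] at key
  obtain ⟨c, d⟩ := key hind'
  rw [norm_sub_rev (hexInv P 4)] at a
  rw [norm_sub_rev (hexInv P 5)] at c
  refine inv_mul_eq_or_mul_inv_eq
    (κ := ‖hexInv P 1 - hexInv P 5‖ / ‖hexInv P 2 - hexInv P 4‖) h2 h4 ?_ ?_ ?_ ?_ b
  · rw [div_mul_eq_mul_div, ← a, mul_div_cancel_right₀ _ n24]
  · rw [div_mul_eq_mul_div, ← c, mul_div_cancel_right₀ _ n24]
  · rw [div_mul_cancel₀ _ n24]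
  · rw [b, d, ← angle_neg_neg, neg_sub, neg_sub]

end

/-! ### Oriented circles under inversion -/

theorem Quaternion.star_inv_smul {s : ℝ} {p : ℍ[ℝ]} (hp : ‖p‖ = 1) :
    star (s • p)⁻¹ = s⁻¹ • p := by
  rw [inv_def, normSq_smul, normSq_eq_norm_mul_self p, hp]
  simp only [Quaternion.star_smul, star_star, smul_smul]
  congr 1
  rcases eq_or_ne s 0 with rfl | hs
  · simp
  · field_simp

namespace OrientedCircle

/-- The inversion at a point `x` of an oriented circle maps the circle to a line of the direction
opposite to the tangent vector. -/
theorem Traverses.exists_line {C : OrientedCircle} {x y z : ℍ[ℝ]} (h : C.Traverses x y z) :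
    ∃ (N v : ℍ[ℝ]) (α β c : ℝ), star (y - x)⁻¹ = N + α • v ∧ star (z - x)⁻¹ = N + β • v ∧
      β < α ∧ 0 < c ∧ C.tangent x = c • v ∧
      ∀ (w : ℍ[ℝ]) (t : ℝ), w ≠ x → star (w - x)⁻¹ = N + t • v → w ∈ C.carrier := by
  cases C with
  | circle o u w r hr hu hw huw =>
    obtain ⟨a, b, c, rfl, rfl, rfl, hab, hbc, hca⟩ := h
    have hwu : inner ℝ w u = 0 := by rw [real_inner_comm]; exact huw
    have unit : ∀ φ : ℝ, ‖-Real.sin φ • u + Real.cos φ • w‖ = 1 := by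
      intro φ
      have e : ‖-Real.sin φ • u + Real.cos φ • w‖ ^ 2 = 1 := by
        rw [← real_inner_self_eq_norm_sq]
        simp only [inner_add_left, inner_add_right, real_inner_smul_left, real_inner_smul_right,
          huw, hwu]
        rw [real_inner_self_eq_norm_sq, real_inner_self_eq_norm_sq, hu, hw]
        linear_combination Real.sin_sq_add_cos_sq φ
      rwa [pow_eq_one_iff_of_nonneg (norm_nonneg _) two_ne_zero] at e
    -- The chord from parameter a to a + 2δ is 2r sin δ times the unit tangent at a + δ. Its inverse
    -- runs along a line with coordinate cot δ / (2r), which decreases on (0, π).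
    have key : ∀ δ : ℝ, Real.sin δ ≠ 0 →
        star ((circle o u w r hr hu hw huw).curve (a + 2 * δ) -
          (circle o u w r hr hu hw huw).curve a)⁻¹ =
        -(2 * r)⁻¹ • (Real.cos a • u + Real.sin a • w) +
          (Real.cos δ / (2 * r * Real.sin δ)) • (-Real.sin a • u + Real.cos a • w) := by
      intro δ hδ
      have e : (circle o u w r hr hu hw huw).curve (a + 2 * δ) -
          (circle o u w r hr hu hw huw).curve a =
          (2 * r * Real.sin δ) • (-Real.sin (a + δ) • u + Real.cos (a + δ) • w) := by
        simp only [curve]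
        rw [show a + 2 * δ = (a + δ) + δ by ring]
        have ca : Real.cos a = Real.cos (a + δ - δ) := by rw [add_sub_cancel_right]
        have sa : Real.sin a = Real.sin (a + δ - δ) := by rw [add_sub_cancel_right]
        rw [ca, sa, Real.cos_add (a + δ), Real.sin_add (a + δ), Real.cos_sub, Real.sin_sub]
        module
      rw [e, Quaternion.star_inv_smul (unit _), Real.sin_add, Real.cos_add]
      match_scalars <;> field_simp <;> ring
    have hpos : ∀ {t}, a < t → t < a + 2 * Real.pi → 0 < Real.sin ((t - a) / 2) := fun h1 h2 =>
      Real.sin_pos_of_pos_of_lt_pi (by linarith) (by linarith)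
    have hb := hpos hab (by linarith)
    have hc := hpos (hab.trans hbc) hca
    have ib : a + 2 * ((b - a) / 2) = b := by ring
    have ic : a + 2 * ((c - a) / 2) = c := by ring
    have kb := key _ hb.ne'
    have kc := key _ hc.ne'
    rw [ib] at kb
    rw [ic] at kc
    refine ⟨_, _, _, _, r, kb, kc, ?_, hr, ?_, ?_⟩
    · rw [div_lt_div_iff₀ (by positivity) (by positivity), ← sub_pos]
      have hs : 0 < Real.sin ((c - a) / 2 - (b - a) / 2) :=
        Real.sin_pos_of_pos_of_lt_pi (by linarith) (by linarith)
      rw [Real.sin_sub] at hs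
      have := mul_pos (mul_pos two_pos hr) hs
      linarith
    · have e : o + (r * Real.cos a) • u + (r * Real.sin a) • w - o =
          (r * Real.cos a) • u + (r * Real.sin a) • w := by abel
      simp only [tangent, curve, e, inner_add_left, real_inner_smul_left, huw, hwu,
        real_inner_self_eq_norm_sq, hu, hw]
      module
    · intro p t _ hp
      have hcos := (Real.cos_arctan_pos (2 * r * t)).ne'
      -- This δ solves cot δ = 2rt.
      have e := key (Real.pi / 2 - Real.arctan (2 * r * t)) (by
        rwa [Real.sin_pi_div_two_sub])
      have e' : Real.sin (Real.arctan (2 * r * t)) /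
          (2 * r * Real.cos (Real.arctan (2 * r * t))) = t := by
        rw [mul_comm (2 * r) (Real.cos _), ← div_div, ← Real.tan_eq_sin_div_cos, Real.tan_arctan]
        field_simp
      rw [Real.sin_pi_div_two_sub, Real.cos_pi_div_two_sub, e', ← hp, star_inj, inv_inj,
        sub_left_inj] at e
      exact ⟨_, e⟩
  | line p u hu =>
    obtain ⟨a, b, c, rfl, rfl, rfl, h⟩ := h
    have key : ∀ t : ℝ, star ((line p u hu).curve t - (line p u hu).curve a)⁻¹ =
        0 + (t - a)⁻¹ • u := by
      intro t
      have e : (line p u hu).curve t - (line p u hu).curve a = (t - a) • u := by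
        simp only [curve]
        module
      rw [e, Quaternion.star_inv_smul hu, zero_add]
    refine ⟨_, _, _, _, 1, key b, key c, ?_, one_pos, (one_smul _ _).symm, ?_⟩
    · rcases h with h | h | h
      · exact inv_strictAnti₀ (by linarith) (by linarith)
      · exact (inv_lt_inv_of_neg (by linarith) (by linarith)).2 (by linarith)
      · exact (inv_lt_zero.2 (by linarith)).trans (inv_pos.2 (by linarith))
    · intro q t _ hq
      -- For t = 0 the convention 0⁻¹ = 0 gives the base point on both sides, so no case distinction
      -- is needed.
      have e := key (a + t⁻¹)
      rw [add_sub_cancel_left, inv_inv, ← hq, star_inj, inv_inj, sub_left_inj] at e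
      exact ⟨_, e⟩

theorem Traverses.tangent_eq {C : OrientedCircle} {x y z : ℍ[ℝ]} (h : C.Traverses x y z) :
    ∃ r : ℝ, 0 < r ∧ C.tangent x = r • star (invDiff x y z) := by
  obtain ⟨N, v, α, β, c, hy, hz, hlt, hc, ht, -⟩ := h.exists_line
  have hd : 0 < α - β := sub_pos.2 hlt
  refine ⟨c / (α - β), div_pos hc hd, ?_⟩
  rw [invDiff, star_sub, hy, hz, add_sub_add_left_eq_sub, ← sub_smul, smul_smul,
    div_mul_cancel₀ _ hd.ne', ht]

/-- A point whose image under the inversion at `x` is collinear with the images of `y` and `z` lies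
on the circle through `x`, `y` and `z`. -/
theorem Traverses.mem_carrier {C : OrientedCircle} {x y z w : ℍ[ℝ]} (h : C.Traverses x y z)
    (hw : w ≠ x) {s : ℝ} (e : (w - x)⁻¹ = (y - x)⁻¹ + s • ((z - x)⁻¹ - (y - x)⁻¹)) :
    w ∈ C.carrier := by
  obtain ⟨N, v, α, β, c, hy, hz, -, -, -, hmem⟩ := h.exists_line
  refine hmem w (α + s * (β - α)) hw ?_
  rw [e, star_add, Quaternion.star_smul, star_sub, hy, hz]
  module

theorem Traverses.rotate {C : OrientedCircle} {x y z : ℍ[ℝ]} (h : C.Traverses x y z) :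
    C.Traverses y z x := by
  cases C with
  | circle o u w r hr hu hw huw =>
    obtain ⟨a, b, c, ha, hb, hc, hab, hbc, hca⟩ := h
    refine ⟨b, c, a + 2 * Real.pi, hb, hc, ?_, hbc, hca, by linarith⟩
    rw [← ha]
    simp only [curve, Real.cos_add_two_pi, Real.sin_add_two_pi]
  | line p u hu =>
    obtain ⟨a, b, c, ha, hb, hc, h⟩ := h
    exact ⟨b, c, a, hb, hc, ha, by tauto⟩

end OrientedCircle

/-! ### Combinatorics of corresponding circles -/

instance : DecidableEq OctVertex := fun v w => by
  cases v <;> cases w <;> first | exact isTrue rfl | exact isFalse nofun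

instance : DecidableEq OctFace := fun f g => by
  cases f <;> cases g <;> first | exact isTrue rfl | exact isFalse nofun

/-- A closed hexagon of edges of the octahedron that contains all vertices. -/
def hexVertex : Fin 6 → OctVertex := ![.v14, .v12, .v24, .v23, .v34, .v13]

/-- The face at a vertex that belongs to a class of corresponding circles. -/
def hexFace : Fin 6 → Fin 4 → OctFace :=
  ![![.s1, .s124, .s4, .s134], ![.s124, .s1, .s2, .s123], ![.s2, .s4, .s124, .s234],
    ![.s234, .s3, .s123, .s2], ![.s3, .s234, .s134, .s4], ![.s134, .s123, .s3, .s1]]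

theorem hexVertex_injective : hexVertex.Injective := by decide

theorem hexVertex_surjective : hexVertex.Surjective := by
  intro v
  cases v
  exacts [⟨1, rfl⟩, ⟨5, rfl⟩, ⟨0, rfl⟩, ⟨3, rfl⟩, ⟨2, rfl⟩, ⟨4, rfl⟩]

theorem hexFace_injective : ∀ i, (hexFace i).Injective := by
  unfold Function.Injective
  decide

theorem OctFace.vertex_hexFace : ∀ i c, ∃ j, (hexFace i c).vertex j = hexVertex i ∧
    (hexFace i c).vertex (j + 1) = hexVertex (hexNext i c).1 ∧
    (hexFace i c).vertex (j + 2) = hexVertex (hexNext i c).2 := by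
  decide

theorem OctFace.has_hexVertex_iff (f : OctFace) (i : Fin 6) :
    f.Has (hexVertex i) ↔ ∃ c, f = hexFace i c := by
  unfold OctFace.Has
  cases f <;> revert i <;> decide

theorem OctFace.opp_hexFace : ∀ i c, ∃ j, (hexVertex i).opp = hexVertex j ∧
    (hexFace i c).opp = hexFace j c := by
  decide

/-- The generating relation along an edge respects the columns of `hexFace`: the two faces on a
common edge exchange their classes from one endpoint to the other. -/
theorem hexFace_edge : ∀ i j, i ≠ j → ∀ c d, hexFace i c = hexFace j d → ∀ c' d',
    hexFace i c' = hexFace j d' → c ≠ c' → c = d' := by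
  decide

/-- Corresponding pairs belong to the same class. -/
theorem OctCorresponds.exists_hexFace {f g : OctFace} {v w : OctVertex}
    (h : OctCorresponds f v g w) :
    ∃ i j c, v = hexVertex i ∧ w = hexVertex j ∧ f = hexFace i c ∧ g = hexFace j c := by
  induction h with
  | edge f g v w hfg hvw hfv hfw hgv hgw =>
    obtain ⟨i, rfl⟩ := hexVertex_surjective v
    obtain ⟨j, rfl⟩ := hexVertex_surjective w
    obtain ⟨c, rfl⟩ := (OctFace.has_hexVertex_iff _ _).1 hfv
    obtain ⟨c', rfl⟩ := (OctFace.has_hexVertex_iff _ _).1 hgv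
    obtain ⟨d, hd⟩ := (OctFace.has_hexVertex_iff _ _).1 hfw
    obtain ⟨d', hd'⟩ := (OctFace.has_hexVertex_iff _ _).1 hgw
    have e := hexFace_edge i j (fun h => hvw (congrArg _ h)) c d hd c' d' hd'
      (fun h => hfg (congrArg _ h))
    exact ⟨i, j, c, rfl, rfl, rfl, e ▸ hd'⟩
  | opposite f v hfv =>
    obtain ⟨i, rfl⟩ := hexVertex_surjective v
    obtain ⟨c, rfl⟩ := (OctFace.has_hexVertex_iff _ _).1 hfv
    obtain ⟨j, hj, hj'⟩ := OctFace.opp_hexFace i c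
    exact ⟨i, j, c, rfl, hj, rfl, hj'⟩
  | refl f v hfv =>
    obtain ⟨i, rfl⟩ := hexVertex_surjective v
    obtain ⟨c, rfl⟩ := (OctFace.has_hexVertex_iff _ _).1 hfv
    exact ⟨i, i, c, rfl, rfl, rfl, rfl⟩
  | symm _ ih =>
    obtain ⟨i, j, c, h1, h2, h3, h4⟩ := ih
    exact ⟨j, i, c, h2, h1, h4, h3⟩
  | trans _ _ ih ih' =>
    obtain ⟨i, j, c, h1, h2, h3, h4⟩ := ih
    obtain ⟨j', k, c', h1', h2', h3', h4'⟩ := ih'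
    obtain rfl := hexVertex_injective (h2.symm.trans h1')
    obtain rfl := hexFace_injective j (h4.symm.trans h3')
    exact ⟨i, k, c, h1, h2', h3, h4'⟩

theorem OctCorresponds.hexFace_edge {i j : Fin 6} {c d : Fin 4} (hij : i ≠ j) (hcd : c ≠ d)
    (h : ∃ d', hexFace i c = hexFace j d') (h' : hexFace i d = hexFace j c) :
    OctCorresponds (hexFace i c) (hexVertex i) (hexFace j c) (hexVertex j) :=
  .edge _ _ _ _ (h' ▸ (hexFace_injective i).ne hcd) (hexVertex_injective.ne hij)
    ((OctFace.has_hexVertex_iff _ _).2 ⟨c, rfl⟩) ((OctFace.has_hexVertex_iff _ _).2 h)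
    ((OctFace.has_hexVertex_iff _ _).2 ⟨d, h'.symm⟩)
    ((OctFace.has_hexVertex_iff _ _).2 ⟨c, rfl⟩)

theorem OctCorresponds.hexFace_zero_three (c : Fin 4) :
    OctCorresponds (hexFace 0 c) (hexVertex 0) (hexFace 3 c) (hexVertex 3) := by
  have h := OctCorresponds.opposite (hexFace 0 c) (hexVertex 0)
    ((OctFace.has_hexVertex_iff _ _).2 ⟨c, rfl⟩)
  have e : ∀ c, (hexFace 0 c).opp = hexFace 3 c := by decide
  rw [e c] at h
  exact h

/-- The common edge accounts only for the two classes of its own faces. The other two pass through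
the opposite vertex, which is also adjacent to the target. -/
theorem OctCorresponds.hexFace_zero_one (c : Fin 4) :
    OctCorresponds (hexFace 0 c) (hexVertex 0) (hexFace 1 c) (hexVertex 1) := by
  fin_cases c
  · exact hexFace_edge (d := 1) (by decide) (by decide) ⟨1, rfl⟩ rfl
  · exact hexFace_edge (d := 0) (by decide) (by decide) ⟨0, rfl⟩ rfl
  · exact (hexFace_zero_three 2).trans
      (hexFace_edge (d := 3) (by decide) (by decide) ⟨3, rfl⟩ rfl)
  · exact (hexFace_zero_three 3).trans
      (hexFace_edge (d := 2) (by decide) (by decide) ⟨2, rfl⟩ rfl)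

theorem OctCorresponds.hexFace_zero_five (c : Fin 4) :
    OctCorresponds (hexFace 0 c) (hexVertex 0) (hexFace 5 c) (hexVertex 5) := by
  fin_cases c
  · exact hexFace_edge (d := 3) (by decide) (by decide) ⟨3, rfl⟩ rfl
  · exact (hexFace_zero_three 1).trans
      (hexFace_edge (d := 2) (by decide) (by decide) ⟨2, rfl⟩ rfl)
  · exact (hexFace_zero_three 2).trans
      (hexFace_edge (d := 1) (by decide) (by decide) ⟨1, rfl⟩ rfl)
  · exact hexFace_edge (d := 0) (by decide) (by decide) ⟨0, rfl⟩ rfl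

/-! ### Application to point-circle configurations -/

namespace OctahedralConfiguration

open InnerProductGeometry

variable (K : OctahedralConfiguration)

/-- The points of a configuration, enumerated along a hexagon. -/
def hexPoint (i : Fin 6) : ℍ[ℝ] := K.point (hexVertex i)

/-- For any two vertices some face contains the first but not the second, so exact incidence
separates the points. -/
theorem hexPoint_injective : K.hexPoint.Injective := by
  intro i j h
  by_contra hij
  have e : ∀ i j, i ≠ j → ∃ c, ∀ d, hexFace i c ≠ hexFace j d := by decide
  obtain ⟨c, hc⟩ := e i j hij
  have hm := (K.mem_carrier_iff (hexVertex i) (hexFace i c)).2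
    ((OctFace.has_hexVertex_iff _ _).2 ⟨c, rfl⟩)
  change K.hexPoint i ∈ _ at hm
  rw [h] at hm
  obtain ⟨d, hd⟩ := (OctFace.has_hexVertex_iff _ _).1 ((K.mem_carrier_iff _ _).1 hm)
  exact hc d hd

theorem traverses_hexFace (i : Fin 6) (c : Fin 4) : (K.circle (hexFace i c)).Traverses
    (K.hexPoint i) (K.hexPoint (hexNext i c).1) (K.hexPoint (hexNext i c).2) := by
  have h : ∀ (f : OctFace) (j : Fin 3), (K.circle f).Traverses (K.point (f.vertex j))
      (K.point (f.vertex (j + 1))) (K.point (f.vertex (j + 2))) := by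
    intro f j
    have h := K.traverses f
    fin_cases j
    exacts [h, h.rotate, h.rotate.rotate]
  obtain ⟨j, h0, h1, h2⟩ := OctFace.vertex_hexFace i c
  have := h (hexFace i c) j
  rwa [h0, h1, h2] at this

theorem angleAt_hexPoint (i : Fin 6) (c d : Fin 4) :
    OrientedCircle.angleAt (K.hexPoint i) (K.circle (hexFace i c)) (K.circle (hexFace i d)) =
      angle (hexTangent K.hexPoint i c) (hexTangent K.hexPoint i d) := by
  obtain ⟨r, hr, h⟩ := (K.traverses_hexFace i c).tangent_eq
  obtain ⟨s, hs, h'⟩ := (K.traverses_hexFace i d).tangent_eq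
  rw [OrientedCircle.angleAt, h, h', angle_smul_left_of_pos _ _ hr, angle_smul_right_of_pos _ _ hs,
    Quaternion.angle_star_star]
  rfl

theorem isGeneralizedClifford_of_sameAngles
    (h : ∀ i j, SameAngles (hexTangent K.hexPoint i) (hexTangent K.hexPoint j)) :
    K.IsGeneralizedClifford := by
  intro v w f g f' g' hf hg
  obtain ⟨i, j, c, rfl, rfl, rfl, rfl⟩ := hf.exists_hexFace
  obtain ⟨i', j', d, hi, hj, rfl, rfl⟩ := hg.exists_hexFace
  obtain rfl := hexVertex_injective hi
  obtain rfl := hexVertex_injective hj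
  exact (K.angleAt_hexPoint i c d).trans ((h i j c d).trans (K.angleAt_hexPoint j c d).symm)

variable {K}

theorem IsGeneralizedClifford.sameAngles (h : K.IsGeneralizedClifford) {i j : Fin 6}
    (hij : ∀ c, OctCorresponds (hexFace i c) (hexVertex i) (hexFace j c) (hexVertex j)) :
    SameAngles (hexTangent K.hexPoint i) (hexTangent K.hexPoint j) := fun c d => by
  rw [← angleAt_hexPoint, ← angleAt_hexPoint]
  exact h _ _ _ _ _ _ (hij c) (hij d)

variable (K)

/-- The points of a configuration on a face at `hexVertex 0`, and a point off that face, are not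
concircular. -/
theorem inv_ne_of_hexFace {c : Fin 4} {k : Fin 6} (hk : k ≠ 0)
    (hc : ∀ d, hexFace 0 c ≠ hexFace k d) (s : ℝ) :
    hexInv K.hexPoint k ≠ hexInv K.hexPoint (hexNext 0 c).1 +
      s • (hexInv K.hexPoint (hexNext 0 c).2 - hexInv K.hexPoint (hexNext 0 c).1) := by
  intro e
  rw [hexInv_sub, hexInv, hexInv, sub_add_eq_add_sub, sub_left_inj] at e
  have hm := (K.traverses_hexFace 0 c).mem_carrier (K.hexPoint_injective.ne hk) e
  obtain ⟨d, hd⟩ := (OctFace.has_hexVertex_iff _ _).1 ((K.mem_carrier_iff _ _).1 hm)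
  exact hc d hd

/-- A relation with `β ≠ 0` would make the images of the points 2, 4, 5 collinear, placing the point
of `v13` on the circle of `s4`, the face with hexagon vertices 0, 2, 4. -/
theorem independent_five (α β : ℝ)
    (e : α • (hexInv K.hexPoint 4 - hexInv K.hexPoint 2) +
      β • (hexInv K.hexPoint 5 - hexInv K.hexPoint 4) = 0) : α = 0 := by
  have hβ : β = 0 := by
    by_contra hβ
    refine K.inv_ne_of_hexFace (c := 2) (k := 5) (by decide) (by decide) (α / β) ?_
    change hexInv K.hexPoint 5 =
      hexInv K.hexPoint 4 + (α / β) • (hexInv K.hexPoint 2 - hexInv K.hexPoint 4)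
    have e' := congrArg (β⁻¹ • ·) e
    simp only [smul_add, smul_zero, inv_smul_smul₀ hβ, smul_smul] at e'
    rw [← sub_eq_zero, ← e']
    module
  rw [hβ, zero_smul, add_zero] at e
  exact (smul_eq_zero.1 e).resolve_right
    (sub_ne_zero.2 ((hexInv_injective K.hexPoint_injective).ne (by decide)))

theorem independent_one (α β : ℝ)
    (e : α • (hexInv K.hexPoint 2 - hexInv K.hexPoint 4) +
      β • (hexInv K.hexPoint 1 - hexInv K.hexPoint 2) = 0) : α = 0 := by
  have hβ : β = 0 := by
    by_contra hβ
    refine K.inv_ne_of_hexFace (c := 2) (k := 1) (by decide) (by decide) (1 - α / β) ?_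
    change hexInv K.hexPoint 1 =
      hexInv K.hexPoint 4 + (1 - α / β) • (hexInv K.hexPoint 2 - hexInv K.hexPoint 4)
    have e' := congrArg (β⁻¹ • ·) e
    simp only [smul_add, smul_zero, inv_smul_smul₀ hβ, smul_smul] at e'
    rw [← sub_eq_zero, ← e']
    module
  rw [hβ, zero_smul, add_zero] at e
  exact (smul_eq_zero.1 e).resolve_right
    (sub_ne_zero.2 ((hexInv_injective K.hexPoint_injective).ne (by decide)))

end OctahedralConfiguration

theorem mainTheorem1 :
    (∀ K : OctahedralConfiguration, K.IsGeneralizedClifford →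
      rightMultiRatio (K.point .v14) (K.point .v12) (K.point .v24)
          (K.point .v23) (K.point .v34) (K.point .v13) = -1 ∨
        leftMultiRatio (K.point .v14) (K.point .v12) (K.point .v24)
          (K.point .v23) (K.point .v34) (K.point .v13) = -1) ∧
    (∀ K : OctahedralConfiguration,
      (rightMultiRatio (K.point .v14) (K.point .v12) (K.point .v24)
          (K.point .v23) (K.point .v34) (K.point .v13) = -1 ∨
        leftMultiRatio (K.point .v14) (K.point .v12) (K.point .v24)
          (K.point .v23) (K.point .v34) (K.point .v13) = -1) →
      K.IsGeneralizedClifford) := by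
  refine ⟨fun K h => ?_, fun K h => K.isGeneralizedClifford_of_sameAngles ?_⟩
  · exact multiRatio_of_sameAngles (P := K.hexPoint) K.hexPoint_injective
      (h.sameAngles OctCorresponds.hexFace_zero_one)
      (h.sameAngles OctCorresponds.hexFace_zero_five) K.independent_five K.independent_one
  · rcases h with h | h
    · exact sameAngles_of_rightMultiRatio (P := K.hexPoint) K.hexPoint_injective h
    · exact sameAngles_of_leftMultiRatio (P := K.hexPoint) K.hexPoint_injective h
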